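/- Let $K$ be a number field with ring of integers $\mathcal O_K$, with $r_1$ real embeddings and $2r_2$ complex embeddings, and put $r=r_1+r_2-1$. Let $d_K$, $h_K$, $R_K$, $\mu_K$ denote the discriminant, the class number, the regulator and the group of roots of unity of $K$, and let $\alpha_K=\lim_{s\to1^+}(s-1)\zeta_K(s)$ be the residue at $s=1$ of the Dedekind zeta function of $K$. Let $\mathfrak q$ be a nonzero ideal of $\mathcal O_K$, put $\varphi(\mathfrak q)=\mathfrak N(\mathfrak q)\prod_{\mathfrak p\mid\mathfrak q}\bigl(1-\tfrac1{\mathfrak N(\mathfrak p)}\bigr)$, the product being over the prime ideals dividing $\mathfrak q$, and let $\mathfrak q_1=\mathfrak q\mathfrak q_\infty$ be the modulus in which $\mathfrak q$ is completed by all Archimedean places. For $\alpha\in K^\times$ write $\alpha\equiv1\bmod^*\mathfrak q_1$ if $\alpha$ is prime to $\mathfrak q$, $v_{\mathfrak p}(\alpha-1)\ge v_{\mathfrak p}(\mathfrak q)$ for all primes $\mathfrak p\mid\mathfrak q$, and $\sigma(\alpha)>0$ for all embeddings $\sigma:K\to\mathbb R$. Let - $h_{K,\mathfrak q}$ be the cardinality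 of the narrow ray class group $I(\mathfrak q)/P_{\mathfrak q}$, where $I(\mathfrak q)$ is the group of fractional ideals of $K$ coprime to $\mathfrak q$ and $P_{\mathfrak q}$ is the subgroup of the principal ideals $(\alpha)$ with $\alpha\equiv1\bmod^*\mathfrak q_1$; - $U_{\mathfrak q_1}$ be the group of the units $u\in\mathcal O_K^*$ with $u\equiv1\bmod^*\mathfrak q_1$, and $\mu_{\mathfrak q_1}=|U_{\mathfrak q_1}\cap\mu_K|$; - $R_{K,\mathfrak q_1}=\bigl|\det\bigl(e_i\log|\sigma_i(\eta_j)|\bigr)_{1\le i,j\le r}\bigr|$, where $\eta_1,\dots,\eta_r\in U_{\mathfrak q_1}$ are multiplicatively independent units that generate $U_{\mathfrak q_1}$ modulo roots of unity, $\sigma_1,\dots,\sigma_r$ are embeddings of $K$ into $\mathbb C$ no two of which are equal or complex conjugate, and $e_i=1$ or $2$ according to whether $\sigma_i$ is real or complex. (This depends neither on the units nor on the embeddings chosen, and it is $1$ if $r=0$.) Then $$\frac{(2\pi)^{r_2}R_{K,\mathfrak q_1}}{\mu_{\mathfrak q_1}\sqrt{|d_K|}}=\frac{\alpha_K\,\varphi(\mathfrak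 q)}{h_{K,\mathfrak q}} \qquad\text{and}\qquad \frac{R_{K,\mathfrak q_1}}{R_K}=\frac{\mu_{\mathfrak q_1}}{|\mu_K|}\cdot\frac{2^{r_1}\varphi(\mathfrak q)h_K}{h_{K,\mathfrak q}}.$$ -/

import Mathlib

open NumberField IsDedekindDomain Filter Topology
open scoped nonZeroDivisors Real

namespace RayClass

noncomputable section

variable (K : Type*) [Field K] [NumberField K]

/-- The residue at `s = 1` of the Dedekind zeta function of `K`, that is the limit of
`(s - 1) ζ_K(s)` as `s` tends to `1` through real numbers `s > 1`. -/
def zetaResidue : ℂ :=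
  limUnder (𝓝[>] (1 : ℝ)) (fun s : ℝ ↦ ((s : ℂ) - 1) * dedekindZeta K (s : ℂ))

/-- The limit that defines the residue exists. -/
theorem tendsto_zetaResidue :
    Tendsto (fun s : ℝ ↦ ((s : ℂ) - 1) * dedekindZeta K (s : ℂ)) (𝓝[>] 1)
      (𝓝 (zetaResidue K)) :=
  tendsto_nhds_limUnder ⟨_, tendsto_sub_one_mul_dedekindZeta_nhdsGT K⟩

variable {K}

open Classical in
/-- The Euler function of an ideal: `φ(𝔮) = N(𝔮) ∏_{𝔭 ∣ 𝔮} (1 - 1 / N(𝔭))`, the product being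
over the distinct prime ideals that divide `𝔮`. -/
def idealPhi (q : Ideal (𝓞 K)) : ℝ :=
  (Ideal.absNorm q : ℝ) *
    ∏ p ∈ (UniqueFactorizationMonoid.normalizedFactors q).toFinset,
      (1 - 1 / (Ideal.absNorm p : ℝ))

/-- `v_𝔭(I)`, the exponent of the prime `𝔭 = v` in the nonzero fractional ideal `I`. -/
abbrev idealOrd (v : HeightOneSpectrum (𝓞 K)) (I : FractionalIdeal (𝓞 K)⁰ K) : ℤ :=
  FractionalIdeal.count K v I

/-- The group `I(𝔮)` of fractional ideals of `K` that are coprime to `𝔮`. -/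
def coprimeIdeals (q : Ideal (𝓞 K)) : Subgroup (FractionalIdeal (𝓞 K)⁰ K)ˣ where
  carrier := {I | ∀ v : HeightOneSpectrum (𝓞 K), v.asIdeal ∣ q → idealOrd v I = 0}
  one_mem' := fun v _ ↦ by simpa using FractionalIdeal.count_one K v
  mul_mem' := fun {I J} hI hJ v hv ↦ by
    rw [idealOrd, Units.val_mul, FractionalIdeal.count_mul K v I.ne_zero J.ne_zero]
    simp [hI v hv, hJ v hv]
  inv_mem' := fun {I} hI v hv ↦ by
    rw [idealOrd, Units.val_inv_eq_inv_val, FractionalIdeal.count_inv]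
    simp [hI v hv]

/-- `α ≡ 1 mod* 𝔮_1`: the element `α` is prime to `𝔮`, `v_𝔭(α - 1) ≥ v_𝔭(𝔮)` for every prime
`𝔭 ∣ 𝔮`, and `σ(α) > 0` for every real embedding `σ`. The `𝔭`-adic valuation is written
multiplicatively here, so that the inequality is reversed. -/
def IsOneModStar (q : Ideal (𝓞 K)) (α : K) : Prop :=
  (∀ v : HeightOneSpectrum (𝓞 K), v.asIdeal ∣ q → v.valuation K α = 1 ∧
    v.valuation K (α - 1) ≤ WithZero.exp (-idealOrd v (q : FractionalIdeal (𝓞 K)⁰ K))) ∧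
  ∀ σ : K →+* ℝ, 0 < σ α

/-- The group of the elements `α` of `Kˣ` with `α ≡ 1 mod* 𝔮_1`. -/
def oneModStar (q : Ideal (𝓞 K)) : Subgroup Kˣ where
  carrier := {α | IsOneModStar q (α : K)}
  one_mem' := ⟨fun v _ ↦ by simp, fun σ ↦ by simp⟩
  mul_mem' := fun {a b} ha hb ↦ by
    refine ⟨fun v hv ↦ ⟨?_, ?_⟩, fun σ ↦ ?_⟩
    · simp [(ha.1 v hv).1, (hb.1 v hv).1]
    · have e : ((a * b : Kˣ) : K) - 1 = ((a : K) - 1) * b + ((b : K) - 1) := by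
        push_cast; ring
      rw [e]
      refine ((v.valuation K).map_add _ _).trans (max_le ?_ (hb.1 v hv).2)
      rw [map_mul, (hb.1 v hv).1, mul_one]
      exact (ha.1 v hv).2
    · simpa using mul_pos (ha.2 σ) (hb.2 σ)
  inv_mem' := fun {a} ha ↦ by
    refine ⟨fun v hv ↦ ⟨?_, ?_⟩, fun σ ↦ ?_⟩
    · simp [(ha.1 v hv).1]
    · have e : ((a⁻¹ : Kˣ) : K) - 1 = -((a : K) - 1) * (a : K)⁻¹ := by
        have := a.ne_zero
        rw [Units.val_inv_eq_inv_val]; field_simp; ring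
      rw [e, map_mul, Valuation.map_neg, map_inv₀, (ha.1 v hv).1, inv_one, mul_one]
      exact (ha.1 v hv).2
    · simpa using ha.2 σ

/-- The group `P_𝔮` of the principal fractional ideals `(α)` with `α ≡ 1 mod* 𝔮_1`. -/
def principalRay (q : Ideal (𝓞 K)) : Subgroup (FractionalIdeal (𝓞 K)⁰ K)ˣ :=
  (oneModStar q).map (toPrincipalIdeal (𝓞 K) K)

/-- The narrow ray class group `H_𝔮(K) = I(𝔮) / P_𝔮`. -/
abbrev NarrowRayClassGroup (q : Ideal (𝓞 K)) : Type _ :=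
  coprimeIdeals q ⧸ (principalRay q).subgroupOf (coprimeIdeals q)

/-- `h_{K,𝔮}`, the cardinality of the narrow ray class group. -/
def narrowRayClassNumber (q : Ideal (𝓞 K)) : ℕ := Nat.card (NarrowRayClassGroup q)

/-- `U_{𝔮_1}`, the group of the units of `𝓞 K` that are `1 mod* 𝔮_1`. -/
def rayUnits (q : Ideal (𝓞 K)) : Subgroup (𝓞 K)ˣ :=
  (oneModStar q).comap (Units.map (algebraMap (𝓞 K) K).toMonoidHom)

/-- `μ_{𝔮_1}`, the number of roots of unity in `U_{𝔮_1}`. -/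
def rayTorsionOrder (q : Ideal (𝓞 K)) : ℕ :=
  Nat.card (rayUnits q ⊓ Units.torsion K : Subgroup (𝓞 K)ˣ)

/-- `η_1, …, η_r`, where `r = r_1 + r_2 - 1`, are multiplicatively independent elements of
`U_{𝔮_1}` that generate `U_{𝔮_1}` modulo the roots of unity. -/
structure IsRayFundSystem (q : Ideal (𝓞 K)) (η : Fin (Units.rank K) → (𝓞 K)ˣ) : Prop where
  mem : ∀ j, η j ∈ rayUnits q
  indep : ∀ n : Fin (Units.rank K) → ℤ, ∏ j, η j ^ n j = 1 → n = 0
  generate : rayUnits q ≤ Subgroup.closure (Set.range η) ⊔ Units.torsion K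

/-- `|det (e_i log |σ_i(η_j)|)_{i,j}|`, where `σ_1, …, σ_r` are all the infinite places but one,
the place `w₀`, and `e_i` is `1` or `2` as `σ_i` is real or complex. -/
def unitDet (w₀ : InfinitePlace K) (σ : Fin (Units.rank K) ≃ {w : InfinitePlace K // w ≠ w₀})
    (η : Fin (Units.rank K) → (𝓞 K)ˣ) : ℝ :=
  |(Matrix.of fun i j : Fin (Units.rank K) ↦
    ((σ i).1.mult : ℝ) * Real.log ((σ i).1 (η j : K))).det|

open Classical in
/-- The `𝔮_1`-regulator `R_{K,𝔮_1}` for `𝔮 ≠ 0`: the value of `unitDet` for some choice of the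
places and of the generating units. By `exists_isRayFundSystem` there are such units, and by
`rayRegulator_eq` the choices do not matter. -/
def rayRegulator (q : Ideal (𝓞 K)) : ℝ :=
  if h : ∃ η, IsRayFundSystem q η then
    unitDet Units.dirichletUnitTheorem.w₀ (Units.equivFinRank K) h.choose
  else 0

theorem unitDet_eq_regOfFamily (w₀ : InfinitePlace K)
    (σ : Fin (Units.rank K) ≃ {w : InfinitePlace K // w ≠ w₀})
    (η : Fin (Units.rank K) → (𝓞 K)ˣ) : unitDet w₀ σ η = Units.regOfFamily η := by
  classical
  rw [Units.regOfFamily_eq_det η w₀ σ.symm, unitDet, ← Matrix.det_transpose,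
    ← Matrix.det_reindex_self σ]
  congr 2
  ext i j
  simp

theorem IsRayFundSystem.sup_eq {q : Ideal (𝓞 K)} {η : Fin (Units.rank K) → (𝓞 K)ˣ}
    (h : IsRayFundSystem q η) :
    Subgroup.closure (Set.range η) ⊔ Units.torsion K = rayUnits q ⊔ Units.torsion K := by
  refine le_antisymm (sup_le_sup_right ?_ _) (sup_le h.generate le_sup_right)
  rw [Subgroup.closure_le]
  rintro _ ⟨j, rfl⟩
  exact h.mem j

/-- The regulator does not depend on the choice of the units and places. -/
theorem rayRegulator_eq {q : Ideal (𝓞 K)} {η : Fin (Units.rank K) → (𝓞 K)ˣ}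
    (h : IsRayFundSystem q η) (w₀ : InfinitePlace K)
    (σ : Fin (Units.rank K) ≃ {w : InfinitePlace K // w ≠ w₀}) :
    rayRegulator q = unitDet w₀ σ η := by
  have hex : ∃ η, IsRayFundSystem q η := ⟨η, h⟩
  have key : ∀ {θ}, IsRayFundSystem q θ → Units.regOfFamily θ =
      (rayUnits q ⊔ Units.torsion K).index * Units.regulator K := fun {θ} hθ ↦ by
    rw [← hθ.sup_eq, ← Units.regOfFamily_div_regulator,
      div_mul_cancel₀ _ (Units.regulator_ne_zero K)]
  rw [rayRegulator, dif_pos hex, unitDet_eq_regOfFamily, unitDet_eq_regOfFamily,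
    key hex.choose_spec, key h]

/-- A fixed power of every unit lies in `U_{𝔮_1}`. -/
theorem exists_pow_mem_rayUnits {q : Ideal (𝓞 K)} (hq : q ≠ ⊥) :
    ∃ n : ℕ, n ≠ 0 ∧ ∀ u : (𝓞 K)ˣ, u ^ n ∈ rayUnits q := by
  classical
  have hfin : Finite (𝓞 K ⧸ q) := Ideal.finiteQuotientOfFreeOfNeBot q hq
  refine ⟨2 * Nat.card (𝓞 K ⧸ q)ˣ, mul_ne_zero two_ne_zero Nat.card_pos.ne', fun u ↦ ?_⟩
  have hmem : ((u ^ (2 * Nat.card (𝓞 K ⧸ q)ˣ) : (𝓞 K)ˣ) : 𝓞 K) - 1 ∈ q := by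
    rw [← Ideal.Quotient.eq_zero_iff_mem, map_sub, map_one, sub_eq_zero, Units.val_pow_eq_pow_val,
      map_pow, mul_comm, pow_mul]
    have := congrArg Units.val
      (pow_card_eq_one' (x := Units.map (Ideal.Quotient.mk q).toMonoidHom u))
    simp only [Units.val_pow_eq_pow_val, Units.val_one] at this
    have h2 : (Ideal.Quotient.mk q (u : 𝓞 K)) ^ Nat.card (𝓞 K ⧸ q)ˣ = 1 := this
    rw [h2, one_pow]
  refine ⟨fun v hv ↦ ⟨?_, ?_⟩, fun σ ↦ ?_⟩
  · set x := u ^ (2 * Nat.card (𝓞 K ⧸ q)ˣ)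
    refine le_antisymm (v.valuation_le_one (x : 𝓞 K)) ?_
    have h1 := v.valuation_le_one (K := K) ((x⁻¹ : (𝓞 K)ˣ) : 𝓞 K)
    have h2 : v.valuation K ((x : 𝓞 K) : K) *
        v.valuation K (((x⁻¹ : (𝓞 K)ˣ) : 𝓞 K) : K) = 1 := by
      rw [← map_mul, ← map_mul, Units.mul_inv, map_one, map_one]
    exact h2.symm.le.trans (mul_le_of_le_one_right' h1)
  · have e : ((Units.map (algebraMap (𝓞 K) K).toMonoidHom
        (u ^ (2 * Nat.card (𝓞 K ⧸ q)ˣ)) : Kˣ) : K) - 1 =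
        algebraMap (𝓞 K) K (((u ^ (2 * Nat.card (𝓞 K ⧸ q)ˣ) : (𝓞 K)ˣ) : 𝓞 K) - 1) := by
      simp
    rw [e, HeightOneSpectrum.valuation_of_algebraMap, idealOrd,
      FractionalIdeal.count_coe K v hq, HeightOneSpectrum.intValuation_le_pow_iff_mem]
    have hdvd : v.asIdeal ^ (Associates.mk v.asIdeal).count (Associates.mk q).factors ∣ q := by
      rw [← Associates.mk_le_mk_iff_dvd, Associates.mk_pow,
        Associates.prime_pow_dvd_iff_le (Associates.mk_ne_zero.mpr hq) v.associates_irreducible]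
    exact Ideal.le_of_dvd hdvd hmem
  · have h0 : σ (((u : 𝓞 K) : K) ^ Nat.card (𝓞 K ⧸ q)ˣ) ≠ 0 := by
      rw [ne_eq, map_eq_zero]
      exact pow_ne_zero _ (Units.coe_ne_zero u)
    have h2 := sq_pos_of_ne_zero h0
    rw [← map_pow, ← pow_mul, mul_comm] at h2
    exact h2

set_option maxSynthPendingDepth 3 in
/-- Independent units that generate `U_{𝔮_1}` modulo the roots of unity exist. -/
theorem exists_isRayFundSystem {q : Ideal (𝓞 K)} (hq : q ≠ ⊥) :
    ∃ η, IsRayFundSystem q η := by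
  classical
  obtain ⟨n, hn, hpow⟩ := exists_pow_mem_rayUnits hq
  let f₀ := QuotientGroup.mk' (Units.torsion K)
  let N : Submodule ℤ (Additive ((𝓞 K)ˣ ⧸ Units.torsion K)) :=
    AddSubgroup.toIntSubmodule (Subgroup.toAddSubgroup ((rayUnits q).map f₀))
  have hN : ∀ x, n • x ∈ N := by
    intro x
    obtain ⟨u, hu⟩ := QuotientGroup.mk_surjective (Additive.toMul x)
    refine ⟨u ^ n, hpow u, ?_⟩
    rw [map_pow]
    change (QuotientGroup.mk u : (𝓞 K)ˣ ⧸ Units.torsion K) ^ n = _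
    rw [hu]; rfl
  have hrank : Module.finrank ℤ N = Units.rank K := by
    rw [← Units.finrank_modTorsion K]
    refine le_antisymm (Submodule.finrank_le N) ?_
    let f : Additive ((𝓞 K)ˣ ⧸ Units.torsion K) →ₗ[ℤ] N :=
      { toFun := fun x ↦ ⟨n • x, hN x⟩
        map_add' := fun x y ↦ Subtype.ext (smul_add n x y)
        map_smul' := fun c x ↦ Subtype.ext (smul_comm n c x) }
    refine LinearMap.finrank_le_finrank_of_injective (f := f) ?_
    intro x y hxy
    have h : n • x = n • y := congrArg Subtype.val hxy
    refine smul_right_injective (R := ℤ) _ (Nat.cast_ne_zero.mpr hn) ?_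
    simpa using h
  let b : Module.Basis (Fin (Units.rank K)) ℤ N := Module.finBasisOfFinrankEq ℤ N hrank
  have hb : ∀ j, ∃ u ∈ rayUnits q, f₀ u = Additive.toMul (b j).1 := fun j ↦ (b j).2
  choose η hη hηb using hb
  have hprod : ∀ m : Fin (Units.rank K) → ℤ,
      Additive.ofMul (f₀ (∏ j, η j ^ m j)) = ((∑ j, m j • b j : N) : Additive _) := by
    intro m
    rw [map_prod, ofMul_prod, Submodule.coe_sum]
    refine Finset.sum_congr rfl fun j _ ↦ ?_
    rw [map_zpow, hηb]; rfl
  refine ⟨η, hη, fun m hm ↦ ?_, fun u hu ↦ ?_⟩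
  · have h := hprod m
    rw [hm, map_one] at h
    have h0 : ∑ j, m j • b j = 0 := Subtype.ext h.symm
    exact funext (Fintype.linearIndependent_iff.mp b.linearIndependent m h0)
  · let x : N := ⟨Additive.ofMul (f₀ u), u, hu, rfl⟩
    have h := hprod (b.repr x)
    rw [b.sum_repr] at h
    have h' : f₀ (∏ j, η j ^ b.repr x j) = f₀ u := h
    have ht : (∏ j, η j ^ b.repr x j)⁻¹ * u ∈ Units.torsion K := QuotientGroup.eq.mp h'
    rw [← mul_inv_cancel_left (∏ j, η j ^ b.repr x j) u]
    refine Subgroup.mul_mem_sup (Subgroup.prod_mem _ fun j _ ↦ ?_) ht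
    exact Subgroup.zpow_mem _ (Subgroup.subset_closure (Set.mem_range_self j)) _

end

end RayClass

/-
Let `f` be the map `α ↦ (α)` on `Kˣ`, whose kernel is the unit group of `𝓞 K`, let `A` be the group
of the `α ∈ Kˣ` prime to `𝔮`, and let `N ≤ A` be that of the `α ≡ 1 mod* 𝔮_1`. Every ideal class
contains an ideal prime to `𝔮`, hence `h_{K,𝔮} = [f(A) : f(N)] h_K = [A : N · ker f] h_K`, while
`[(𝓞 K)ˣ : U_{𝔮_1}] = [N · ker f : N]`. The product of the two is `[A : N] h_K`. Elements of `A` are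
quotients of integers prime to `𝔮`, and such integers realize every unit residue class modulo `𝔮`
together with every choice of signs, so `[A : N] = 2^{r_1} φ(𝔮)`. Finally `R_{K,𝔮_1} / R_K` is the
index of `U_{𝔮_1} · μ_K` in `(𝓞 K)ˣ`, which is `[(𝓞 K)ˣ : U_{𝔮_1}] μ_{𝔮_1} / |μ_K|`. This is the
second identity; the first follows from it by the class number formula.
-/

namespace RayClass

section FiniteRing

theorem natCard_units_of_isLocalHom {R S : Type*} [Ring R] [Finite R] [DivisionRing S]
    {f : R →+* S} [IsLocalHom f] (hf : Function.Surjective f) :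
    (Nat.card Rˣ : ℝ) = Nat.card R * (1 - 1 / (Nat.card S : ℝ)) := by
  classical
  have : Finite S := Finite.of_surjective f hf
  let N := f.toAddMonoidHom.ker
  have h_mul : Nat.card N * Nat.card S = Nat.card R := by
    rw [← N.card_mul_index, AddSubgroup.index_ker, AddMonoidHom.range_eq_top.mpr hf,
      AddSubgroup.card_top]
  have h_isUnit (x : R) : IsUnit x ↔ x ∉ N := by
    rw [← isUnit_map_iff f, isUnit_iff_ne_zero]
    rfl
  have h_add : Nat.card N + Nat.card Rˣ = Nat.card R := by
    rw [← Nat.card_congr (Equiv.sumCompl (· ∈ N)), Nat.card_sum,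
      Nat.card_congr ((Equiv.ofInjective _ Units.val_injective).trans
        (Equiv.subtypeEquivRight h_isUnit))]
  have hS : (Nat.card S : ℝ) ≠ 0 := Nat.cast_ne_zero.mpr Nat.card_pos.ne'
  rw [← h_mul] at h_add ⊢
  have h_add' : (Nat.card N + Nat.card Rˣ : ℝ) = Nat.card N * Nat.card S := mod_cast h_add
  push_cast
  field_simp
  linear_combination h_add'

theorem natCard_units_quotient_pow {R : Type*} [CommRing R] (p : Ideal R) [p.IsMaximal] {e : ℕ}
    (he : e ≠ 0) [Finite (R ⧸ p ^ e)] :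
    (Nat.card (R ⧸ p ^ e)ˣ : ℝ) = Nat.card (R ⧸ p ^ e) * (1 - 1 / (Nat.card (R ⧸ p) : ℝ)) := by
  let : Field (R ⧸ p) := Ideal.Quotient.field p
  let f : R ⧸ p ^ e →+* R ⧸ p := Ideal.Quotient.factor (Ideal.pow_le_self he)
  have : IsLocalHom f := ⟨fun x hx ↦ by
    obtain ⟨x, rfl⟩ := Ideal.Quotient.mk_surjective x
    exact (Ideal.Quotient.isUnit_mk_pow_iff_isUnit_mk p he).mpr hx⟩
  exact natCard_units_of_isLocalHom (f := f) (Ideal.Quotient.factor_surjective _)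

open Classical UniqueFactorizationMonoid in
theorem natCard_units_quotient {R : Type*} [CommRing R] [IsDedekindDomain R] {q : Ideal R}
    (hq : q ≠ ⊥) [Finite (R ⧸ q)] :
    (Nat.card (R ⧸ q)ˣ : ℝ) =
      Nat.card (R ⧸ q) * ∏ p ∈ (normalizedFactors q).toFinset,
        (1 - 1 / (Nat.card (R ⧸ p) : ℝ)) := by
  let e := IsDedekindDomain.quotientEquivPiFactors hq
  have h_factor (P : (factors q).toFinset) :
      (Nat.card (R ⧸ P.1 ^ (factors q).count P.1)ˣ : ℝ) =
        Nat.card (R ⧸ P.1 ^ (factors q).count P.1) * (1 - 1 / (Nat.card (R ⧸ P.1) : ℝ)) := by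
    have hP := Multiset.mem_toFinset.mp P.2
    have hP' := prime_of_factor _ hP
    have := (Ideal.isPrime_of_prime hP').isMaximal hP'.ne_zero
    have : Finite (R ⧸ P.1 ^ (factors q).count P.1) :=
      Finite.of_surjective (fun x ↦ e x P) ((Function.surjective_eval P).comp e.surjective)
    exact natCard_units_quotient_pow P.1 (Multiset.count_ne_zero.mpr hP)
  rw [Nat.card_congr ((Units.mapEquiv e.toMulEquiv).trans MulEquiv.piUnits).toEquiv,
    Nat.card_congr e.toEquiv, Nat.card_pi, Nat.card_pi, Nat.cast_prod, Nat.cast_prod,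
    Finset.prod_congr rfl fun P _ ↦ h_factor P, Finset.prod_mul_distrib,
    Finset.prod_coe_sort _ fun P ↦ (1 - 1 / (Nat.card (R ⧸ P) : ℝ)),
    factors_eq_normalizedFactors]

end FiniteRing

section Group

theorem index_sup_mul_natCard {G : Type*} [CommGroup G] (H T : Subgroup G) :
    (H ⊔ T).index * Nat.card T = H.index * Nat.card (H ⊓ T : Subgroup G) := by
  have h_index : H.relIndex T * (H ⊔ T).index = H.index := by
    rw [← Subgroup.relIndex_sup_left, Subgroup.relIndex_mul_index le_sup_left]
  have h_card : Nat.card (H ⊓ T : Subgroup G) * H.relIndex T = Nat.card T := by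
    rw [← Subgroup.relIndex_bot_left, ← Subgroup.relIndex_bot_left,
      ← Subgroup.inf_relIndex_right H T, Subgroup.relIndex_mul_relIndex _ _ _ bot_le inf_le_right]
  rw [← h_card, ← h_index]
  ring

/-- Every class of `G ⧸ N` is represented by some `i x`: the class of `i a / i b` is that of `i x`
whenever `j x = j a / j b`. -/
theorem index_eq_natCard {M G H : Type*} [Monoid M] [Group G] [Group H] {i : M →* G} {j : M →* H}
    (hi : ∀ α, ∃ a b, i b * α = i a) (hj : Function.Surjective j) {N : Subgroup G}
    (hN : ∀ a b, (i a)⁻¹ * i b ∈ N ↔ j a = j b) : N.index = Nat.card H := by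
  let f : M → G ⧸ N := fun a ↦ i a
  have hf : Function.Surjective f := by
    intro c
    obtain ⟨α, rfl⟩ := QuotientGroup.mk_surjective c
    obtain ⟨a, b, hab⟩ := hi α
    obtain ⟨x, hx⟩ := hj ((j b)⁻¹ * j a)
    have h_fraction : (i x)⁻¹ * α = (i (b * x))⁻¹ * i a := by
      rw [← hab, map_mul, mul_inv_rev, mul_assoc, inv_mul_cancel_left]
    refine ⟨x, QuotientGroup.eq.mpr ?_⟩
    rw [h_fraction, hN, map_mul, hx, mul_inv_cancel_left]
  have h_ker : Setoid.ker f = Setoid.ker j :=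
    Setoid.ext fun a b ↦ QuotientGroup.eq.trans (hN a b)
  rw [Subgroup.index, ← Nat.card_congr (Setoid.quotientKerEquivOfSurjective f hf), h_ker,
    Nat.card_congr (Setoid.quotientKerEquivOfSurjective j hj)]

end Group

section DedekindDomain

variable {R : Type*} [CommRing R] [IsDedekindDomain R] {q : Ideal R}

theorem sup_eq_top_iff_forall_not_le (hq : q ≠ ⊥) {I : Ideal R} :
    q ⊔ I = ⊤ ↔ ∀ v : HeightOneSpectrum R, v.asIdeal ∣ q → ¬ I ≤ v.asIdeal := by
  refine ⟨fun h v hv hI ↦ v.isPrime.ne_top (top_le_iff.mp (h ▸ sup_le (Ideal.le_of_dvd hv) hI)),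
    fun h ↦ ?_⟩
  by_contra hne
  obtain ⟨m, hm, hle⟩ := Ideal.exists_le_maximal _ hne
  have hqm : q ≤ m := le_sup_left.trans hle
  exact h ⟨m, hm.isPrime, fun h0 ↦ hq (le_bot_iff.mp (h0 ▸ hqm))⟩ (Ideal.dvd_iff_le.mpr hqm)
    (le_sup_right.trans hle)

variable (K : Type*) [Field K] [Algebra R K] [IsFractionRing R K]

theorem isUnit_mk_iff_forall_valuation_eq_one (hq : q ≠ ⊥) (z : R) :
    IsUnit (Ideal.Quotient.mk q z) ↔
      ∀ v : HeightOneSpectrum R, v.asIdeal ∣ q → v.valuation K (algebraMap R K z) = 1 := by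
  have h_sup : IsUnit (Ideal.Quotient.mk q z) ↔ q ⊔ Ideal.span {z} = ⊤ := by
    rw [← Ideal.span_singleton_eq_top, ← Set.image_singleton, ← Ideal.map_span,
      ← Ideal.comap_eq_top_iff (f := Ideal.Quotient.mk q), Ideal.comap_map_quotientMk]
  simp only [h_sup, sup_eq_top_iff_forall_not_le hq, Ideal.span_singleton_le_iff_mem,
    HeightOneSpectrum.valuation_eq_one_iff_notMem]

theorem mem_iff_forall_valuation_le (hq : q ≠ ⊥) (z : R) :
    z ∈ q ↔ ∀ v : HeightOneSpectrum R, v.asIdeal ∣ q →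
      v.valuation K (algebraMap R K z) ≤
        WithZero.exp (-FractionalIdeal.count K v (q : FractionalIdeal R⁰ K)) := by
  classical
  simp only [HeightOneSpectrum.valuation_of_algebraMap, FractionalIdeal.count_coe K _ hq,
    HeightOneSpectrum.intValuation_le_pow_iff_mem]
  conv_lhs => rw [← Ideal.iInf_maxPowDividing_eq hq, Submodule.mem_iInf]
  refine forall_congr' fun v ↦ ⟨fun h _ ↦ h, fun h ↦ ?_⟩
  by_cases hv : v.asIdeal ∣ q
  · exact h hv
  · rw [HeightOneSpectrum.maxPowDividing, not_not.mp ((Associates.count_ne_zero_iff_dvd hq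
      v.irreducible).not.mpr hv), pow_zero, Ideal.one_eq_top]
    exact Submodule.mem_top

variable {K}

theorem exists_algebraMap_mul_eq (hq : q ≠ ⊥) {α : K}
    (hα : ∀ v : HeightOneSpectrum R, v.asIdeal ∣ q → v.valuation K α ≤ 1) :
    ∃ a b : R, b ≠ 0 ∧ IsUnit (Ideal.Quotient.mk q b) ∧
      algebraMap R K b * α = algebraMap R K a := by
  -- the ideal of the denominators of `α`, which no prime divisor of `q` contains
  let J : Ideal R := (1 : Submodule R K).comap (LinearMap.toSpanSingleton R K α)
  have mem_J (b : R) : b ∈ J ↔ ∃ a, algebraMap R K b * α = algebraMap R K a := by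
    simp only [J, Submodule.mem_comap, LinearMap.toSpanSingleton_apply, Submodule.mem_one,
      Algebra.smul_def, eq_comm]
  have h_coprime : q ⊔ J = ⊤ := by
    refine (sup_eq_top_iff_forall_not_le hq).mpr fun v hv hJ ↦ ?_
    obtain ⟨n, d, hd⟩ := v.exists_primeCompl_mul_eq_of_integer α (hα v hv)
    exact d.2 (hJ ((mem_J d).mpr ⟨n, mul_comm α _ ▸ hd⟩))
  rcases eq_or_ne q ⊤ with rfl | hqt
  · obtain ⟨a, b, hb, rfl⟩ := IsFractionRing.div_surjective (A := R) α
    have : Subsingleton (R ⧸ (⊤ : Ideal R)) := Ideal.Quotient.subsingleton_iff.mpr rfl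
    exact ⟨a, b, nonZeroDivisors.ne_zero hb, isUnit_of_subsingleton _,
      mul_div_cancel₀ _ (IsFractionRing.to_map_ne_zero_of_mem_nonZeroDivisors hb)⟩
  · obtain ⟨c, hc, b, hb, hcb⟩ := Submodule.mem_sup.mp ((Ideal.eq_top_iff_one _).mp h_coprime)
    obtain ⟨a, ha⟩ := (mem_J b).mp hb
    have hb1 : Ideal.Quotient.mk q b = 1 := by
      rw [← map_one (Ideal.Quotient.mk q), ← hcb, map_add,
        Ideal.Quotient.eq_zero_iff_mem.mpr hc, zero_add]
    refine ⟨a, b, ?_, hb1 ▸ isUnit_one, ha⟩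
    rintro rfl
    rw [add_zero] at hcb
    exact hqt ((Ideal.eq_top_iff_one _).mpr (hcb ▸ hc))

theorem count_coeIdeal_eq_zero (hq : q ≠ ⊥) {A : Ideal R} (hA : A ≠ ⊥) (h : q ⊔ A = ⊤)
    {v : HeightOneSpectrum R} (hv : v.asIdeal ∣ q) :
    FractionalIdeal.count K v (A : FractionalIdeal R⁰ K) = 0 := by
  classical
  rw [FractionalIdeal.count_coe K v hA, Nat.cast_eq_zero]
  by_contra hne
  exact (sup_eq_top_iff_forall_not_le hq).mp h v hv
    (Ideal.le_of_dvd ((Associates.count_ne_zero_iff_dvd hA v.irreducible).mp hne))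

theorem count_spanSingleton_eq_zero_iff (v : HeightOneSpectrum R) {x : K} (hx : x ≠ 0) :
    FractionalIdeal.count K v (FractionalIdeal.spanSingleton R⁰ x) = 0 ↔ v.valuation K x = 1 := by
  classical
  obtain ⟨a, b, hb, rfl⟩ := IsFractionRing.div_surjective (A := R) x
  have hb0 : b ≠ 0 := nonZeroDivisors.ne_zero hb
  have ha0 : a ≠ 0 := by rintro rfl; simp at hx
  have h_eq : FractionalIdeal.spanSingleton R⁰ (algebraMap R K a / algebraMap R K b) =
      FractionalIdeal.spanSingleton R⁰ (algebraMap R K b)⁻¹ * (Ideal.span {a} : Ideal R) := by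
    rw [FractionalIdeal.coeIdeal_span_singleton,
      FractionalIdeal.spanSingleton_mul_spanSingleton, div_eq_inv_mul]
  rw [FractionalIdeal.count_well_defined K v (FractionalIdeal.spanSingleton_ne_zero_iff.mpr hx)
    h_eq, map_div₀, HeightOneSpectrum.valuation_of_algebraMap,
    HeightOneSpectrum.valuation_of_algebraMap, v.intValuation_if_neg ha0,
    v.intValuation_if_neg hb0, ← WithZero.exp_sub, ← WithZero.exp_zero, WithZero.exp_inj]
  omega

theorem exists_spanSingleton_mul_eq_coeIdeal (hq : q ≠ ⊥) {I : FractionalIdeal R⁰ K} (hI : I ≠ 0) :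
    ∃ x : K, ∃ A : Ideal R, x ≠ 0 ∧ q ⊔ A = ⊤ ∧ FractionalIdeal.spanSingleton R⁰ x * I = A := by
  obtain ⟨x, hx⟩ := IsDedekindDomain.exists_add_spanSingleton_mul_eq
    (FractionalIdeal.coeIdeal_le_one (I := q)) (FractionalIdeal.coeIdeal_ne_zero.mpr hq) hI
  rcases eq_or_ne x 0 with rfl | hx0
  · have hqt : q = ⊤ := by
      simpa [FractionalIdeal.spanSingleton_zero] using hx
    exact ⟨_, I.num, IsFractionRing.to_map_ne_zero_of_mem_nonZeroDivisors I.den.2,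
      by rw [hqt, top_sup_eq], FractionalIdeal.den_mul_self_eq_num' _ _ I⟩
  · obtain ⟨A, hA⟩ := FractionalIdeal.le_one_iff_exists_coeIdeal.mp
      (hx ▸ le_add_of_nonneg_left (FractionalIdeal.zero_le _))
    refine ⟨x, A, hx0, ?_, hA.symm⟩
    rw [← hA, ← FractionalIdeal.coeIdeal_sup, FractionalIdeal.coeIdeal_eq_one] at hx
    exact hx.trans Ideal.one_eq_top

end DedekindDomain

theorem ker_toPrincipalIdeal (R K : Type*) [CommRing R] [Field K] [Algebra R K]
    [IsFractionRing R K] :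
    (toPrincipalIdeal R K).ker = (Units.map (algebraMap R K).toMonoidHom).range := by
  rw [← Submodule.ker_unitsMap_spanSingleton]
  ext x
  rw [MonoidHom.mem_ker, MonoidHom.mem_ker, toPrincipalIdeal_eq_iff, Units.ext_iff,
    ← FractionalIdeal.coeToSubmodule_inj]
  simp

section Signs

variable {K : Type*} [Field K]

/-- The infinite place below a real embedding. -/
noncomputable def realPlace (σ : K →+* ℝ) : InfinitePlace K :=
  InfinitePlace.mk (Complex.ofRealHom.comp σ)

theorem realPlace_apply (σ : K →+* ℝ) (x : K) : realPlace σ x = |σ x| := by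
  simp [realPlace]

theorem isReal_ofRealHom_comp (σ : K →+* ℝ) :
    ComplexEmbedding.IsReal (Complex.ofRealHom.comp σ) := by
  ext x
  simp [ComplexEmbedding.conjugate_coe_eq]

theorem ofRealHom_comp_injective :
    Function.Injective fun σ : K →+* ℝ ↦ Complex.ofRealHom.comp σ :=
  fun _ _ h ↦ RingHom.ext fun x ↦ Complex.ofReal_injective (RingHom.congr_fun h x)

theorem realPlace_injective : Function.Injective (realPlace (K := K)) := by
  intro σ τ h
  rw [realPlace, realPlace, InfinitePlace.mk_eq_iff,
    ComplexEmbedding.isReal_iff.mp (isReal_ofRealHom_comp σ), or_self] at h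
  exact ofRealHom_comp_injective h

/-- The signs of a nonzero element of `K` at the real embeddings. -/
noncomputable def signs : Kˣ →* ((K →+* ℝ) → SignTypeˣ) :=
  MonoidHom.pi fun σ ↦ Units.map ((signHom : ℝ →*₀ SignType).toMonoidHom.comp σ)

theorem coe_signs_apply (x : Kˣ) (σ : K →+* ℝ) :
    (signs x σ : SignType) = SignType.sign (σ x) :=
  rfl

theorem signs_eq_one_iff {x : Kˣ} : signs x = 1 ↔ ∀ σ : K →+* ℝ, 0 < σ x := by
  simp [funext_iff, Units.ext_iff, coe_signs_apply, sign_eq_one_iff]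

variable [NumberField K]

theorem natCard_signs :
    Nat.card ((K →+* ℝ) → SignTypeˣ) = 2 ^ InfinitePlace.nrRealPlaces K := by
  classical
  have h_card : Nat.card (K →+* ℝ) = InfinitePlace.nrRealPlaces K := by
    rw [← InfinitePlace.card_real_embeddings, ← Nat.card_eq_fintype_card]
    refine Nat.card_congr (Equiv.ofBijective (fun σ ↦ ⟨_, isReal_ofRealHom_comp σ⟩)
      ⟨fun σ τ h ↦ ofRealHom_comp_injective (congrArg Subtype.val h), fun ⟨φ, hφ⟩ ↦ ?_⟩)
    exact ⟨hφ.embedding, Subtype.ext (RingHom.ext fun x ↦ hφ.coe_embedding_apply x)⟩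
  rw [Nat.card_fun, h_card, Nat.card_eq_fintype_card]
  rfl

theorem exists_forall_infinitePlace_sub_lt (a : InfinitePlace K → K) {ε : ℝ} (hε : 0 < ε) :
    ∃ t : K, ∀ v : InfinitePlace K, v (a v - t) < ε := by
  obtain ⟨t, ht⟩ := (InfinitePlace.denseRange_algebraMap_pi K).exists_dist_lt
    (fun v ↦ WithAbs.toAbs v.1 (a v)) hε
  exact ⟨t, fun v ↦ (dist_eq_norm _ _).symm.trans_lt ((dist_pi_lt_iff hε).mp ht v)⟩

theorem sign_eq_of_abs_sub_lt_one {s : SignType} (hs : s ≠ 0) {x : ℝ} (h : |(s : ℝ) - x| < 1) :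
    SignType.sign x = s := by
  rw [abs_lt] at h
  cases s with
  | zero => exact absurd rfl hs
  | neg => exact sign_neg (by norm_num at h; linarith)
  | pos => exact sign_pos (by norm_num at h; linarith)

theorem signs_surjective : Function.Surjective (signs (K := K)) := by
  intro s
  rcases isEmpty_or_nonempty (K →+* ℝ) with _ | ⟨⟨σ₀⟩⟩
  · exact ⟨1, Subsingleton.elim _ _⟩
  obtain ⟨t, ht⟩ := exists_forall_infinitePlace_sub_lt
    (Function.extend realPlace (fun σ ↦ ((s σ : SignType) : K)) 1) one_pos
  have h_sign (σ : K →+* ℝ) : SignType.sign (σ t) = s σ := by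
    have h := ht (realPlace σ)
    rw [realPlace_injective.extend_apply, realPlace_apply, map_sub] at h
    exact sign_eq_of_abs_sub_lt_one (s σ).ne_zero (by simpa [SignType.map_cast] using h)
  have ht0 : t ≠ 0 := by
    rintro rfl
    exact (s σ₀).ne_zero (by simpa using (h_sign σ₀).symm)
  exact ⟨Units.mk0 t ht0, funext fun σ ↦ Units.ext (h_sign σ)⟩

theorem eventually_sign_add_mul_natCast (a : ℝ) {b : ℝ} (hb : b ≠ 0) :
    ∀ᶠ m : ℕ in atTop, SignType.sign (a + b * m) = SignType.sign b := by
  rcases hb.lt_or_gt with hb | hb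
  · have h := tendsto_atBot_add_const_left atTop a
      ((tendsto_natCast_atTop_atTop (R := ℝ)).const_mul_atTop_of_neg hb)
    filter_upwards [h.eventually_lt_atBot 0] with m hm
    rw [sign_neg hm, sign_neg hb]
  · have h := tendsto_atTop_add_const_left atTop a
      ((tendsto_natCast_atTop_atTop (R := ℝ)).const_mul_atTop hb)
    filter_upwards [h.eventually_gt_atTop 0] with m hm
    rw [sign_pos hm, sign_pos hb]

theorem exists_mem_forall_sign_eq {q : Ideal (𝓞 K)} (hq : q ≠ ⊥) (s : (K →+* ℝ) → SignTypeˣ) :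
    ∃ t ∈ q, t ≠ 0 ∧ ∀ σ : K →+* ℝ, SignType.sign (σ t) = s σ := by
  obtain ⟨u, rfl⟩ := signs_surjective s
  obtain ⟨a, b, hb, hab⟩ := IsFractionRing.div_surjective (A := 𝓞 K) (u : K)
  obtain ⟨c, hc, hc0⟩ := Submodule.exists_mem_ne_zero_of_ne_bot hq
  have hb0 : b ≠ 0 := nonZeroDivisors.ne_zero hb
  have h_eq : ((a * b * c ^ 2 : 𝓞 K) : K) = u * ((b * c : 𝓞 K) : K) ^ 2 := by
    have : (b : K) ≠ 0 := by simpa using hb0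
    rw [← hab]
    push_cast
    field_simp
  refine ⟨a * b * c ^ 2, q.mul_mem_left _ (Ideal.pow_mem_of_mem q hc 2 two_pos), ?_, fun σ ↦ ?_⟩
  · refine RingOfIntegers.coe_ne_zero_iff.mp (h_eq.trans_ne ?_)
    simp [hb0, hc0]
  · have h_pos : 0 < σ ((b * c : 𝓞 K) : K) ^ 2 := sq_pos_of_ne_zero (by simp [hb0, hc0])
    rw [h_eq, map_mul, map_pow, sign_mul, sign_pos h_pos, mul_one, coe_signs_apply]

theorem exists_sub_mem_forall_sign_eq {q : Ideal (𝓞 K)} (hq : q ≠ ⊥) (x : 𝓞 K)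
    (s : (K →+* ℝ) → SignTypeˣ) :
    ∃ y : 𝓞 K, y ≠ 0 ∧ y - x ∈ q ∧ ∀ σ : K →+* ℝ, SignType.sign (σ y) = s σ := by
  obtain ⟨t, htq, ht0, ht⟩ := exists_mem_forall_sign_eq hq s
  have h_ne : ∀ᶠ m : ℕ in atTop, x + t * m ≠ 0 := by
    have h_inj : Function.Injective fun m : ℕ ↦ x + t * m :=
      (add_right_injective x).comp ((mul_right_injective₀ ht0).comp Nat.cast_injective)
    rw [← Nat.cofinite_eq_atTop]
    exact h_inj.tendsto_cofinite.eventually (eventually_cofinite_ne 0)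
  have h_sign (σ : K →+* ℝ) :
      ∀ᶠ m : ℕ in atTop, SignType.sign (σ ((x + t * m : 𝓞 K) : K)) = s σ := by
    filter_upwards [eventually_sign_add_mul_natCast (σ x) (b := σ t) (by simpa using ht0)] with m hm
    rw [← ht σ, ← hm]
    simp
  obtain ⟨m, hm, hm'⟩ := (h_ne.and (eventually_all.mpr h_sign)).exists
  exact ⟨_, hm, by simpa using q.mul_mem_right _ htq, hm'⟩

end Signs

section RayClassNumber

variable {K : Type*} [Field K] {q : Ideal (𝓞 K)}

/-- The monoid of the nonzero algebraic integers that are prime to `q`. -/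
def coprimeIntegers (q : Ideal (𝓞 K)) : Submonoid (𝓞 K) :=
  (𝓞 K)⁰ ⊓ (IsUnit.submonoid (𝓞 K ⧸ q)).comap (Ideal.Quotient.mk q)

namespace coprimeIntegers

/-- A nonzero algebraic integer prime to `q`, as an element of `Kˣ`. -/
noncomputable def toFieldUnits (q : Ideal (𝓞 K)) : coprimeIntegers q →* Kˣ :=
  IsUnit.liftRight ((algebraMap (𝓞 K) K).toMonoidHom.comp (coprimeIntegers q).subtype)
    fun a ↦ (RingOfIntegers.coe_ne_zero_iff.mpr (nonZeroDivisors.ne_zero a.2.1)).isUnit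

@[simp]
theorem coe_toFieldUnits (a : coprimeIntegers q) :
    (toFieldUnits q a : K) = algebraMap (𝓞 K) K a :=
  rfl

/-- The residue class modulo `q` of an algebraic integer prime to `q`. -/
noncomputable def residue (q : Ideal (𝓞 K)) : coprimeIntegers q →* (𝓞 K ⧸ q)ˣ :=
  IsUnit.liftRight ((Ideal.Quotient.mk q).toMonoidHom.comp (coprimeIntegers q).subtype)
    fun a ↦ a.2.2

@[simp]
theorem coe_residue (a : coprimeIntegers q) : (residue q a : 𝓞 K ⧸ q) = Ideal.Quotient.mk q a :=
  rfl

/-- The signs at the real embeddings and the residue class modulo `q`. -/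
noncomputable def signsResidue (q : Ideal (𝓞 K)) :
    coprimeIntegers q →* ((K →+* ℝ) → SignTypeˣ) × (𝓞 K ⧸ q)ˣ :=
  (signs.comp (toFieldUnits q)).prod (residue q)

end coprimeIntegers

variable [NumberField K]

/-- The group of the elements of `Kˣ` that are prime to `q`. -/
noncomputable def coprimeElements (q : Ideal (𝓞 K)) : Subgroup Kˣ :=
  (coprimeIdeals q).comap (toPrincipalIdeal (𝓞 K) K)

theorem mem_coprimeElements_iff {α : Kˣ} :
    α ∈ coprimeElements q ↔
      ∀ v : HeightOneSpectrum (𝓞 K), v.asIdeal ∣ q → v.valuation K (α : K) = 1 := by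
  refine forall₂_congr fun v _ ↦ ?_
  rw [coe_toPrincipalIdeal, idealOrd, count_spanSingleton_eq_zero_iff v α.ne_zero]

theorem oneModStar_le_coprimeElements (q : Ideal (𝓞 K)) : oneModStar q ≤ coprimeElements q :=
  fun _ hα ↦ mem_coprimeElements_iff.mpr fun v hv ↦ (hα.1 v hv).1

namespace coprimeIntegers

theorem valuation_eq_one (hq : q ≠ ⊥) (a : coprimeIntegers q) {v : HeightOneSpectrum (𝓞 K)}
    (hv : v.asIdeal ∣ q) : v.valuation K (toFieldUnits q a : K) = 1 :=
  (isUnit_mk_iff_forall_valuation_eq_one K hq _).mp a.2.2 v hv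

/-- The canonical homomorphism to the group of the elements of `Kˣ` prime to `q`. -/
noncomputable def toCoprimeElements (hq : q ≠ ⊥) : coprimeIntegers q →* coprimeElements q :=
  (toFieldUnits q).codRestrict _ fun a ↦
    mem_coprimeElements_iff.mpr fun _ ↦ valuation_eq_one hq a

theorem exists_toCoprimeElements_mul_eq (hq : q ≠ ⊥) (α : coprimeElements q) :
    ∃ a b, toCoprimeElements hq b * α = toCoprimeElements hq a := by
  have hα := mem_coprimeElements_iff.mp α.2
  obtain ⟨a, b, hb0, hb, hab⟩ := exists_algebraMap_mul_eq hq fun v hv ↦ (hα v hv).le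
  have hb0' : algebraMap (𝓞 K) K b ≠ 0 := by simpa using hb0
  have ha0 : a ≠ 0 := by
    rintro rfl
    simp [hb0] at hab
  have ha : IsUnit (Ideal.Quotient.mk q a) := by
    rw [isUnit_mk_iff_forall_valuation_eq_one K hq] at hb ⊢
    intro v hv
    rw [← hab, map_mul, hb v hv, hα v hv, one_mul]
  exact ⟨⟨a, mem_nonZeroDivisors_of_ne_zero ha0, ha⟩, ⟨b, mem_nonZeroDivisors_of_ne_zero hb0, hb⟩,
    Subtype.ext (Units.ext hab)⟩

theorem signsResidue_surjective (hq : q ≠ ⊥) : Function.Surjective (signsResidue q) := by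
  rintro ⟨s, c⟩
  obtain ⟨x, hx⟩ := Ideal.Quotient.mk_surjective c.1
  obtain ⟨y, hy0, hyx, hys⟩ := exists_sub_mem_forall_sign_eq hq x s
  have hyc : Ideal.Quotient.mk q y = c := (Ideal.Quotient.eq.mpr hyx).trans hx
  have hy : IsUnit (Ideal.Quotient.mk q y) := hyc ▸ c.isUnit
  exact ⟨⟨y, mem_nonZeroDivisors_of_ne_zero hy0, hy⟩,
    Prod.ext (funext fun σ ↦ Units.ext (hys σ)) (Units.ext hyc)⟩

theorem residue_eq_residue_iff (hq : q ≠ ⊥) (a b : coprimeIntegers q) :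
    residue q a = residue q b ↔ ∀ v : HeightOneSpectrum (𝓞 K), v.asIdeal ∣ q →
      v.valuation K ((toFieldUnits q a : K)⁻¹ * toFieldUnits q b - 1) ≤
        WithZero.exp (-idealOrd v (q : FractionalIdeal (𝓞 K)⁰ K)) := by
  rw [eq_comm, Units.ext_iff, coe_residue, coe_residue, Ideal.Quotient.eq,
    mem_iff_forall_valuation_le K hq]
  refine forall₂_congr fun v hv ↦ ?_
  have h_sub : (toFieldUnits q a : K)⁻¹ * toFieldUnits q b - 1 =
      (toFieldUnits q a : K)⁻¹ * algebraMap (𝓞 K) K (b - a) := by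
    rw [map_sub, mul_sub, ← coe_toFieldUnits, ← coe_toFieldUnits,
      inv_mul_cancel₀ (toFieldUnits q a).ne_zero]
  rw [h_sub, map_mul, map_inv₀, valuation_eq_one hq a hv, inv_one, one_mul]

theorem inv_mul_mem_oneModStar_iff (hq : q ≠ ⊥) (a b : coprimeIntegers q) :
    (toFieldUnits q a)⁻¹ * toFieldUnits q b ∈ oneModStar q ↔
      signsResidue q a = signsResidue q b := by
  have h_signs : signs (toFieldUnits q a) = signs (toFieldUnits q b) ↔
      ∀ σ : K →+* ℝ, 0 < σ (((toFieldUnits q a)⁻¹ * toFieldUnits q b : Kˣ) : K) := by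
    rw [← inv_mul_eq_one, ← map_inv, ← map_mul, signs_eq_one_iff]
  rw [signsResidue, MonoidHom.prod_apply, MonoidHom.prod_apply, Prod.mk_inj, MonoidHom.comp_apply,
    MonoidHom.comp_apply, h_signs, residue_eq_residue_iff hq, and_comm]
  refine and_congr_left' (forall₂_congr fun v hv ↦ ?_)
  rw [Units.val_mul, Units.val_inv_eq_inv_val]
  refine and_iff_right ?_
  rw [map_mul, map_inv₀, valuation_eq_one hq a hv, valuation_eq_one hq b hv, inv_one, one_mul]

end coprimeIntegers

open coprimeIntegers in
theorem relIndex_oneModStar_coprimeElements (hq : q ≠ ⊥) :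
    (oneModStar q).relIndex (coprimeElements q) =
      2 ^ InfinitePlace.nrRealPlaces K * Nat.card (𝓞 K ⧸ q)ˣ := by
  rw [← natCard_signs, ← Nat.card_prod]
  exact index_eq_natCard (exists_toCoprimeElements_mul_eq hq) (signsResidue_surjective hq)
    (inv_mul_mem_oneModStar_iff hq)

theorem range_toPrincipalIdeal_sup_coprimeIdeals (hq : q ≠ ⊥) :
    (toPrincipalIdeal (𝓞 K) K).range ⊔ coprimeIdeals q = ⊤ := by
  refine eq_top_iff.mpr fun I _ ↦ ?_
  obtain ⟨x, A, hx, hqA, hxI⟩ := exists_spanSingleton_mul_eq_coeIdeal hq I.ne_zero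
  have hA : A ≠ ⊥ := by
    rintro rfl
    rw [FractionalIdeal.coeIdeal_bot] at hxI
    exact mul_ne_zero (FractionalIdeal.spanSingleton_ne_zero_iff.mpr hx) I.ne_zero hxI
  let y := toPrincipalIdeal (𝓞 K) K (Units.mk0 x hx)
  have hyI : y * I ∈ coprimeIdeals q := fun v hv ↦ by
    rw [Units.val_mul, coe_toPrincipalIdeal, Units.val_mk0, hxI]
    exact count_coeIdeal_eq_zero hq hA hqA hv
  rw [← inv_mul_cancel_left y I]
  exact Subgroup.mul_mem_sup (inv_mem ⟨_, rfl⟩) hyI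

theorem index_range_toPrincipalIdeal :
    (toPrincipalIdeal (𝓞 K) K).range.index = classNumber K := by
  rw [classNumber, ← Nat.card_eq_fintype_card, Subgroup.index,
    Nat.card_congr (ClassGroup.equiv K).toEquiv]

theorem ker_toPrincipalIdeal_le_coprimeElements (q : Ideal (𝓞 K)) :
    (toPrincipalIdeal (𝓞 K) K).ker ≤ coprimeElements q :=
  Subgroup.comap_mono bot_le

theorem narrowRayClassNumber_eq (hq : q ≠ ⊥) :
    narrowRayClassNumber q =
      (oneModStar q ⊔ (toPrincipalIdeal (𝓞 K) K).ker).relIndex (coprimeElements q) *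
        classNumber K := by
  set f := toPrincipalIdeal (𝓞 K) K
  have h_map : (coprimeElements q).map f = f.range ⊓ coprimeIdeals q :=
    Subgroup.map_comap_eq f (coprimeIdeals q)
  have h_le : principalRay q ≤ f.range ⊓ coprimeIdeals q :=
    h_map ▸ Subgroup.map_mono (oneModStar_le_coprimeElements q)
  have h_principal : (principalRay q).relIndex (f.range ⊓ coprimeIdeals q) =
      (oneModStar q ⊔ f.ker).relIndex (coprimeElements q) := by
    rw [← h_map, principalRay, Subgroup.relIndex_map_map,
      sup_eq_left.mpr (ker_toPrincipalIdeal_le_coprimeElements q)]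
  have h_class : (f.range ⊓ coprimeIdeals q).relIndex (coprimeIdeals q) = classNumber K := by
    rw [Subgroup.inf_relIndex_right, ← Subgroup.relIndex_sup_left (coprimeIdeals q) f.range,
      range_toPrincipalIdeal_sup_coprimeIdeals hq, Subgroup.relIndex_top_right,
      index_range_toPrincipalIdeal]
  rw [← h_principal, ← h_class]
  exact (Subgroup.relIndex_mul_relIndex _ _ _ h_le inf_le_right).symm

theorem index_rayUnits (q : Ideal (𝓞 K)) :
    (rayUnits q).index =
      (oneModStar q).relIndex (oneModStar q ⊔ (toPrincipalIdeal (𝓞 K) K).ker) := by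
  rw [rayUnits, Subgroup.index_comap, Subgroup.relIndex_sup_left, ker_toPrincipalIdeal]

theorem narrowRayClassNumber_mul_index_rayUnits (hq : q ≠ ⊥) :
    narrowRayClassNumber q * (rayUnits q).index =
      2 ^ InfinitePlace.nrRealPlaces K * Nat.card (𝓞 K ⧸ q)ˣ * classNumber K := by
  rw [narrowRayClassNumber_eq hq, index_rayUnits, ← relIndex_oneModStar_coprimeElements hq,
    ← Subgroup.relIndex_mul_relIndex _ _ _ le_sup_left
      (sup_le (oneModStar_le_coprimeElements q) (ker_toPrincipalIdeal_le_coprimeElements q))]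
  ring

end RayClassNumber

section Regulator

variable {K : Type*} [Field K] [NumberField K] {q : Ideal (𝓞 K)}

theorem natCard_units_quotient_eq_idealPhi (hq : q ≠ ⊥) :
    (Nat.card (𝓞 K ⧸ q)ˣ : ℝ) = idealPhi q := by
  have : Finite (𝓞 K ⧸ q) := Ideal.finiteQuotientOfFreeOfNeBot q hq
  exact natCard_units_quotient hq

theorem narrowRayClassNumber_ne_zero (hq : q ≠ ⊥) : narrowRayClassNumber q ≠ 0 := by
  have : Finite (𝓞 K ⧸ q) := Ideal.finiteQuotientOfFreeOfNeBot q hq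
  refine left_ne_zero_of_mul (b := (rayUnits q).index) ?_
  rw [narrowRayClassNumber_mul_index_rayUnits hq]
  exact mul_ne_zero (mul_ne_zero (by positivity) Nat.card_pos.ne') (classNumber_ne_zero K)

theorem rayTorsionOrder_ne_zero (q : Ideal (𝓞 K)) : rayTorsionOrder q ≠ 0 := by
  have : Finite (rayUnits q ⊓ Units.torsion K : Subgroup (𝓞 K)ˣ) :=
    Finite.of_injective _ (Subgroup.inclusion_injective inf_le_right)
  exact Nat.card_pos.ne'

theorem index_rayUnits_sup_torsion_mul_torsionOrder (q : Ideal (𝓞 K)) :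
    (rayUnits q ⊔ Units.torsion K).index * Units.torsionOrder K =
      (rayUnits q).index * rayTorsionOrder q :=
  index_sup_mul_natCard _ _

theorem rayRegulator_eq_index_mul_regulator (hq : q ≠ ⊥) :
    rayRegulator q = (rayUnits q ⊔ Units.torsion K).index * Units.regulator K := by
  obtain ⟨η, hη⟩ := exists_isRayFundSystem hq
  rw [rayRegulator_eq hη Units.dirichletUnitTheorem.w₀ (Units.equivFinRank K),
    unitDet_eq_regOfFamily, ← hη.sup_eq, ← Units.regOfFamily_div_regulator,
    div_mul_cancel₀ _ (Units.regulator_ne_zero K)]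

theorem rayRegulator_div_regulator (hq : q ≠ ⊥) :
    rayRegulator q / Units.regulator K =
      (rayTorsionOrder q : ℝ) / (Units.torsionOrder K : ℝ) *
        (2 ^ InfinitePlace.nrRealPlaces K * idealPhi q * (classNumber K : ℝ) /
          (narrowRayClassNumber q : ℝ)) := by
  have h_class : (narrowRayClassNumber q : ℝ) * (rayUnits q).index =
      2 ^ InfinitePlace.nrRealPlaces K * idealPhi q * classNumber K := by
    rw [← natCard_units_quotient_eq_idealPhi hq]
    exact_mod_cast narrowRayClassNumber_mul_index_rayUnits hq
  have h_torsion : ((rayUnits q ⊔ Units.torsion K).index : ℝ) * Units.torsionOrder K =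
      (rayUnits q).index * rayTorsionOrder q :=
    mod_cast index_rayUnits_sup_torsion_mul_torsionOrder q
  have h_order : (Units.torsionOrder K : ℝ) ≠ 0 :=
    Nat.cast_ne_zero.mpr (Units.torsionOrder_ne_zero K)
  rw [rayRegulator_eq_index_mul_regulator hq, mul_div_cancel_right₀ _ (Units.regulator_ne_zero K),
    ← h_class, mul_div_cancel_left₀ _ (Nat.cast_ne_zero.mpr (narrowRayClassNumber_ne_zero hq)),
    div_mul_eq_mul_div, eq_div_iff h_order, h_torsion, mul_comm]

theorem two_pi_pow_mul_rayRegulator_div (hq : q ≠ ⊥) :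
    (2 * π) ^ InfinitePlace.nrComplexPlaces K * rayRegulator q /
        ((rayTorsionOrder q : ℝ) * √|(discr K : ℝ)|) =
      dedekindZeta_residue K * idealPhi q / (narrowRayClassNumber q : ℝ) := by
  have h_ray : (rayTorsionOrder q : ℝ) ≠ 0 := Nat.cast_ne_zero.mpr (rayTorsionOrder_ne_zero q)
  rw [(div_eq_iff (Units.regulator_ne_zero K)).mp (rayRegulator_div_regulator hq),
    dedekindZeta_residue_def]
  field_simp

theorem zetaResidue_eq_dedekindZeta_residue (K : Type*) [Field K] [NumberField K] :
    zetaResidue K = dedekindZeta_residue K :=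
  tendsto_nhds_unique (tendsto_zetaResidue K) (tendsto_sub_one_mul_dedekindZeta_nhdsGT K)

end Regulator

end RayClass

theorem lemma3p9 {K : Type*} [Field K] [NumberField K] (q : Ideal (𝓞 K)) (hq : q ≠ ⊥) :
    (((2 * π) ^ InfinitePlace.nrComplexPlaces K * RayClass.rayRegulator q /
          ((RayClass.rayTorsionOrder q : ℝ) * √|(discr K : ℝ)|) : ℝ) : ℂ) =
        RayClass.zetaResidue K * (RayClass.idealPhi q : ℂ) /
          (RayClass.narrowRayClassNumber q : ℂ) ∧
      RayClass.rayRegulator q / Units.regulator K =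
        (RayClass.rayTorsionOrder q : ℝ) / (Units.torsionOrder K : ℝ) *
          (2 ^ InfinitePlace.nrRealPlaces K * RayClass.idealPhi q * (classNumber K : ℝ) /
            (RayClass.narrowRayClassNumber q : ℝ)) := by
  refine ⟨?_, RayClass.rayRegulator_div_regulator hq⟩
  rw [RayClass.two_pi_pow_mul_rayRegulator_div hq, RayClass.zetaResidue_eq_dedekindZeta_residue,
    Complex.ofReal_div, Complex.ofReal_mul, Complex.ofReal_natCast]
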